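/- Let $p$ be a prime, $G$ a (topologically) finitely generated pro-$p$ group, and $L$ a $\mathbb{Z}_p$-lattice of dimension $d$ equipped with a right $G$-action, i.e. a right module over the group ring $\mathbb{Z}_pG$ that is finitely generated and torsion-free as a $\mathbb{Z}_p$-module, with $d=\dim_{\mathbb{Z}_p}L$. Let $\mathfrak{a}_G=\sum_{g\in G}(g-1)\mathbb{Z}_pG+p\,\mathbb{Z}_pG$, and let $\lambda_i(L)=L.\mathfrak{a}_G^{\,i}$ ($i\in\mathbb{N}_0$) be the lower $p$-series of $L$. A filtration series of $L$ is a descending chain $L=L_0\supseteq L_1\supseteq\dots$ of open $\mathbb{Z}_p$-sublattices with $\bigcap_i L_i=\{0\}$; the lower $p$-series is one. Two filtration series $(L_i)$, $(L_i^*)$ are equivalent if there is $c\in\mathbb{N}_0$ such that $p^cL_i\subseteq L_i^*$ and $p^cL_i^*\subseteq L_i$ for all $i\ge 1$. A filtration series has a stratification given by the frame $(x_1,\dots,x_d)$, a $\mathbb{Z}_p$-basis of $L$, with growth rate $(\xi_1,\dots,\xi_d)$, if $0<\xi_1\le\dots\le\xi_d$ are real numbers such that the series is equivalent to $L_i^*=\bigoplus_{k=1}^d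 p^{\lfloor i\xi_k\rfloor}\mathbb{Z}_p x_k$ ($i\in\mathbb{N}_0$). Then the lower $p$-series of $L$ admits a stratification, and any two stratifications of it have the same growth rate. Moreover, if $(x_1,\dots,x_d)$ is the frame of any stratification of the lower $p$-series of $L$, with growth rate $(\xi_1,\dots,\xi_d)$, then 1. $1/d\le\xi_1\le\dots\le\xi_d\le 1$ are rational numbers; 2. for every $e\in\{1,\dots,d-1\}$ with $\xi_e<\xi_{e+1}$, the sublattice $\bigoplus_{k=1}^e\mathbb{Z}_px_k$ is $G$-invariant; 3. every term $\bigoplus_{k=1}^d p^{\lfloor i\xi_k\rfloor}\mathbb{Z}_px_k$ ($i\in\mathbb{N}_0$) of the stratification is $G$-invariant. -/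

import Mathlib

/-- A topological group is a pro-`p` group: it is profinite, and every open normal subgroup has
`p`-power index. -/
structure IsProPGroup (p : ℕ) (G : Type*) [Group G] [TopologicalSpace G] : Prop where
  isTopologicalGroup : IsTopologicalGroup G
  compactSpace : CompactSpace G
  t2Space : T2Space G
  totallyDisconnectedSpace : TotallyDisconnectedSpace G
  index_eq_pow : ∀ N : Subgroup G, N.Normal → IsOpen (N : Set G) → ∃ n : ℕ, N.index = p ^ n

/-- (Topological) finite generation: some finitely generated abstract subgroup is dense. -/
def IsTopFinitelyGenerated (G : Type*) [Group G] [TopologicalSpace G] : Prop :=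
  ∃ S : Finset G, Dense (Subgroup.closure (S : Set G) : Set G)

/-- The opposite of the group ring `ℤ_p G`. A right `ℤ_p G`-module is, as usual in Mathlib, a module
over this ring: the element `x . α` is written `MulOpposite.op α • x`. -/
abbrev GroupRingOp (p : ℕ) [Fact p.Prime] (G : Type*) [Group G] : Type _ :=
  (MonoidAlgebra ℤ_[p] G)ᵐᵒᵖ

/-- The `p`-augmentation ideal `𝔞_G = ∑_g (g - 1) ℤ_p G + p ℤ_p G`, i.e. the right ideal of `ℤ_p G`
generated by `p` and all `g - 1`, viewed as a left ideal of the opposite ring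
(it is two-sided, so its powers are the same on either side). -/
noncomputable def pAugmentationIdeal (p : ℕ) [Fact p.Prime] (G : Type*) [Group G] : Ideal (GroupRingOp p G) :=
  Ideal.span
    (insert (MulOpposite.op (p : MonoidAlgebra ℤ_[p] G))
      (Set.range fun g : G => MulOpposite.op (MonoidAlgebra.of ℤ_[p] G g - 1)))

/-- The lower `p`-series `λ_i(L) = L . 𝔞_G ^ i` of a right `ℤ_p G`-module `L`, as a sequence of
`ℤ_p`-submodules. -/
noncomputable def lowerPSeries (p : ℕ) [Fact p.Prime] (G : Type*) [Group G]
    (L : Type*) [AddCommGroup L] [Module ℤ_[p] L] [Module (GroupRingOp p G) L]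
    [IsScalarTower ℤ_[p] (GroupRingOp p G) L] (i : ℕ) : Submodule ℤ_[p] L :=
  (pAugmentationIdeal p G ^ i • (⊤ : Submodule (GroupRingOp p G) L)).restrictScalars ℤ_[p]

/-- `G`-invariance of a `ℤ_p`-sublattice `M`: `x . g ∈ M` for all `x ∈ M`, `g ∈ G`. -/
def IsGInvariant (p : ℕ) [Fact p.Prime] (G : Type*) [Group G]
    {L : Type*} [AddCommGroup L] [Module ℤ_[p] L] [Module (GroupRingOp p G) L]
    (M : Submodule ℤ_[p] L) : Prop :=
  ∀ g : G, ∀ x ∈ M,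
    (MulOpposite.op (MonoidAlgebra.of ℤ_[p] G g) : GroupRingOp p G) • x ∈ M

section Lattice

/-- A filtration series of a `ℤ_p`-lattice `L`: a descending chain of sublattices that starts at `L`,
whose terms are open (contain `p ^ n L` for some `n`) and intersect in `0`. -/
structure IsFiltrationSeries (p : ℕ) [Fact p.Prime] {L : Type*} [AddCommGroup L] [Module ℤ_[p] L]
    (S : ℕ → Submodule ℤ_[p] L) : Prop where
  zero_eq_top : S 0 = ⊤
  antitone : Antitone S
  isOpen : ∀ i, ∃ n : ℕ, ∀ x : L, (p : ℤ_[p]) ^ n • x ∈ S i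
  iInf_eq_bot : ⨅ i, S i = ⊥

/-- `c`-equivalence of two series: `p ^ c S_i ⊆ T_i` and `p ^ c T_i ⊆ S_i` for all `i ≥ 1`. -/
def CEquivalent (p : ℕ) [Fact p.Prime] {L : Type*} [AddCommGroup L] [Module ℤ_[p] L]
    (c : ℕ) (S T : ℕ → Submodule ℤ_[p] L) : Prop :=
  ∀ i : ℕ, 1 ≤ i →
    (∀ x ∈ S i, (p : ℤ_[p]) ^ c • x ∈ T i) ∧ (∀ x ∈ T i, (p : ℤ_[p]) ^ c • x ∈ S i)

/-- The series `⨁_k p ^ ⌊i ξ_k⌋ ℤ_p x_k`, `i ∈ ℕ₀`. -/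
noncomputable def stratum (p : ℕ) [Fact p.Prime] {L : Type*} [AddCommGroup L] [Module ℤ_[p] L]
    {d : ℕ} (x : Module.Basis (Fin d) ℤ_[p] L) (ξ : Fin d → ℝ) (i : ℕ) : Submodule ℤ_[p] L :=
  Submodule.span ℤ_[p] (Set.range fun k => (p : ℤ_[p]) ^ ⌊(i : ℝ) * ξ k⌋₊ • x k)

/-- The filtration series `S` has a stratification given by the frame `x`, with growth rate `ξ`. -/
structure IsStratification (p : ℕ) [Fact p.Prime] {L : Type*} [AddCommGroup L] [Module ℤ_[p] L]
    {d : ℕ} (S : ℕ → Submodule ℤ_[p] L) (x : Module.Basis (Fin d) ℤ_[p] L) (ξ : Fin d → ℝ) :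
    Prop where
  isFiltrationSeries : IsFiltrationSeries p S
  pos : ∀ k, 0 < ξ k
  monotone : Monotone ξ
  equivalent : ∃ c : ℕ, CEquivalent p c S (stratum p x ξ)

end Lattice

/-! Existence uses only that `I = 𝔞_G` is an ideal of a `ℤ_p`-algebra `R` with `p ∈ I`. If every
nonzero submodule of `L` is open, compactness leaves only finitely many submodules up to powers of
`p`. By pigeonhole `I ^ (b + i) L = p ^ a I ^ i L` for some `b > 0`, so the series shrinks at the
rational rate `a / b`. In general, a saturated submodule and its quotient are glued, and the slower
of their rates is the slowest rate `ρ` of `L` (`exists_hasMinimalSlope`).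

A second compactness argument gives a nonzero saturated `M` that realises `ρ`: up to a bounded power
of `p`, `p ^ ⌊i ρ⌋ M ⊆ I ^ i L ⊆ p ^ ⌊i ρ⌋ L` (`exists_slowest_submodule`). Because `ρ` is slowest,
arbitrary lifts of a frame of `L / M`, together with any basis of `M`, form a frame of `L`.
Induction on the rank concludes (`exists_hasGrowth`).

Uniqueness and invariance have one source, `HasGrowth.repr_apply_eq_zero`: a linear map that
preserves the series has no matrix entry from a slower to a strictly faster direction. It is applied
to the identity and to the action of `G`.

For the bounds, `p ^ i L ⊆ λ_i(L)` gives `ξ k ≤ 1`. Since `G` is pro-`p`, it acts unipotently on `L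
/ p L`, so `𝔞_G ^ d L ⊆ p L` and `1 / d ≤ ξ k`. -/

section Lattices

open scoped Pointwise

/-! ### Compactness and Nakayama for lattices -/

section ZpModule

variable {p : ℕ} [Fact p.Prime] {L : Type*} [AddCommGroup L] [Module ℤ_[p] L]

theorem pow_p_ne_zero (n : ℕ) : (p : ℤ_[p]) ^ n ≠ 0 :=
  pow_ne_zero n (Nat.cast_ne_zero.2 (Fact.out : p.Prime).ne_zero)

theorem pow_p_smul_injective [Module.IsTorsionFree ℤ_[p] L] (n : ℕ) :
    Function.Injective fun x : L => (p : ℤ_[p]) ^ n • x :=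
  smul_right_injective L (pow_p_ne_zero n)

theorem eq_zero_of_forall_pow_p_dvd {a : ℤ_[p]} (h : ∀ n : ℕ, (p : ℤ_[p]) ^ n ∣ a) : a = 0 := by
  by_contra ha
  have := (PadicInt.mem_span_pow_iff_le_valuation a ha (a.valuation + 1)).1
    (Ideal.mem_span_singleton.2 (h _))
  omega

variable [Module.Finite ℤ_[p] L] [Module.IsTorsionFree ℤ_[p] L]

/-- Sequential compactness of a lattice. -/
theorem exists_frequently_sub_eq_pow_smul (y : ℕ → L) :
    ∃ z : L, ∀ m N : ℕ, ∃ n ≥ N, ∃ w : L, y n - z = (p : ℤ_[p]) ^ m • w := by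
  let b := Module.finBasis ℤ_[p] L
  obtain ⟨f, φ, hφ, hf⟩ := CompactSpace.tendsto_subseq fun n => b.equivFun (y n)
  refine ⟨b.equivFun.symm f, fun m N => ?_⟩
  have hp : (0 : ℝ) < (p : ℝ) ^ (-m : ℤ) :=
    zpow_pos (Nat.cast_pos.2 (Fact.out : p.Prime).pos) _
  obtain ⟨K, hK⟩ := (Metric.tendsto_atTop.1 hf) _ hp
  refine ⟨φ (max K N), (le_max_right K N).trans (hφ.id_le _), ?_⟩
  have h1 := hK (max K N) (le_max_left K N)
  have h2 : ∀ k, ∃ a, b.equivFun (y (φ (max K N))) k - f k = (p : ℤ_[p]) ^ m * a := by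
    intro k
    have h3 : ‖b.equivFun (y (φ (max K N))) k - f k‖ ≤ (p : ℝ) ^ (-m : ℤ) := by
      rw [dist_eq_norm] at h1
      exact (norm_le_pi_norm (b.equivFun (y (φ (max K N))) - f) k).trans h1.le
    exact Ideal.mem_span_singleton.1 ((PadicInt.norm_le_pow_iff_mem_span_pow _ _).1 h3)
  choose a ha using h2
  refine ⟨b.equivFun.symm a, b.equivFun.injective ?_⟩
  rw [map_sub, map_smul, LinearEquiv.apply_symm_apply, LinearEquiv.apply_symm_apply]
  exact funext ha

end ZpModule

variable {p : ℕ} [Fact p.Prime] {R : Type*} [Ring R] [Algebra ℤ_[p] R]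
  {L : Type*} [AddCommGroup L] [Module ℤ_[p] L] [Module R L] [IsScalarTower ℤ_[p] R L]

theorem ideal_smul_zp_smul (J : Ideal R) (a : ℤ_[p]) (N : Submodule R L) :
    J • (a • N) = a • (J • N) :=
  (Submodule.map_smul'' J N (DistribSMul.toLinearMap R L a)).symm

theorem zp_smul_le (a : ℤ_[p]) (N : Submodule R L) : a • N ≤ N := by
  rintro _ ⟨x, hx, rfl⟩
  show a • x ∈ N
  rw [← algebraMap_smul R a x]
  exact N.smul_mem _ hx

theorem zp_smul_mem (N : Submodule R L) (a : ℤ_[p]) {x : L} (hx : x ∈ N) : a • x ∈ N :=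
  zp_smul_le a N (Submodule.smul_mem_pointwise_smul _ _ _ hx)

theorem pow_p_smul_le_pow_p_smul {m n : ℕ} (h : m ≤ n) (N : Submodule R L) :
    (p : ℤ_[p]) ^ n • N ≤ (p : ℤ_[p]) ^ m • N := by
  obtain ⟨k, rfl⟩ := Nat.exists_eq_add_of_le h
  rw [pow_add, mul_smul]
  exact smul_mono_right _ (zp_smul_le _ _)

variable [Module.Finite ℤ_[p] L]

/-- Nakayama over the local ring `ℤ_p`. -/
theorem le_of_le_sup_p_smul {M N : Submodule R L} (h : N ≤ M ⊔ (p : ℤ_[p]) • N) : N ≤ M := by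
  have hN : (N.restrictScalars ℤ_[p]).FG := IsNoetherian.noetherian _
  have hI : Ideal.span {(p : ℤ_[p])} ≤ (⊥ : Ideal ℤ_[p]).jacobson := by
    rw [IsLocalRing.jacobson_eq_maximalIdeal _ bot_ne_top, PadicInt.maximalIdeal_eq_span_p]
  have := Submodule.le_of_le_smul_of_le_jacobson_bot (N := M.restrictScalars ℤ_[p]) hN hI
    (fun x hx => by
      obtain ⟨m, hm, n, hn, rfl⟩ := Submodule.mem_sup.1 (h hx)
      refine Submodule.mem_sup.2 ⟨m, hm, n, ?_, rfl⟩
      obtain ⟨y, hy, rfl⟩ := hn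
      exact Submodule.smul_mem_smul (Ideal.mem_span_singleton_self _) hy)
  exact this

/-- If every nonzero submodule is open, then the submodules not contained in `p L` are uniformly
open. -/
theorem exists_pow_smul_top_le_of_irreducible [Module.IsTorsionFree ℤ_[p] L]
    (hirr : ∀ M : Submodule R L, M ≠ ⊥ → ∃ m : ℕ, (p : ℤ_[p]) ^ m • (⊤ : Submodule R L) ≤ M) :
    ∃ c : ℕ, ∀ M : Submodule R L, ¬ M ≤ (p : ℤ_[p]) • (⊤ : Submodule R L) →
      (p : ℤ_[p]) ^ c • (⊤ : Submodule R L) ≤ M := by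
  by_contra! hcon
  choose M hM hM' using hcon
  have hy : ∀ n, ∃ y ∈ M n, y ∉ (p : ℤ_[p]) • (⊤ : Submodule R L) := fun n =>
    Set.not_subset.1 (hM n)
  choose y hyM hyp using hy
  obtain ⟨z, hz⟩ := exists_frequently_sub_eq_pow_smul (p := p) y
  have hz0 : z ≠ 0 := by
    rintro rfl
    obtain ⟨n, -, w, hw⟩ := hz 1 0
    apply hyp n
    rw [sub_zero, pow_one] at hw
    rw [hw]
    exact Submodule.smul_mem_pointwise_smul _ _ _ trivial
  obtain ⟨m, hm⟩ := hirr (Submodule.span R {z}) (by simpa using hz0)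
  -- Here `p ^ m L ⊆ R z` and `z ∈ M n + p ^ (m + 1) L`, so Nakayama gives `p ^ m L ⊆ M n`. As `n ≥
  -- m`, this contradicts the choice of `M n`.
  obtain ⟨n, hn, w, hw⟩ := hz (m + 1) m
  refine hM' n ((pow_p_smul_le_pow_p_smul hn _).trans (le_of_le_sup_p_smul (p := p) (hm.trans ?_)))
  rw [Submodule.span_singleton_le_iff_mem, smul_smul, ← pow_succ']
  have : z = y n + (p : ℤ_[p]) ^ (m + 1) • (-w) := by rw [smul_neg, ← hw]; abel
  rw [this]
  exact Submodule.add_mem_sup (hyM n) (Submodule.smul_mem_pointwise_smul _ _ _ trivial)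

end Lattices

/-! ### Powers of an ideal, saturation, and periodicity on irreducible lattices -/

section Lattices

open scoped Pointwise

variable {p : ℕ} [Fact p.Prime] {R : Type*} [Ring R] [Algebra ℤ_[p] R]
  {L : Type*} [AddCommGroup L] [Module ℤ_[p] L] [Module R L] [IsScalarTower ℤ_[p] R L]

theorem zp_smul_mono (a : ℤ_[p]) {M N : Submodule R L} (h : M ≤ N) : a • M ≤ a • N :=
  smul_mono_right a h

theorem exists_of_mem_pow_smul_top {n : ℕ} {x : L}
    (h : x ∈ (p : ℤ_[p]) ^ n • (⊤ : Submodule R L)) : ∃ y : L, x = (p : ℤ_[p]) ^ n • y := by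
  obtain ⟨y, -, rfl⟩ := h
  exact ⟨y, rfl⟩

theorem pow_smul_mem_pow_smul_top (n : ℕ) (x : L) :
    (p : ℤ_[p]) ^ n • x ∈ (p : ℤ_[p]) ^ n • (⊤ : Submodule R L) :=
  Submodule.smul_mem_pointwise_smul _ _ _ trivial

theorem pow_smul_mem_pow_smul_iff [Module.IsTorsionFree ℤ_[p] L] {n : ℕ} {x : L}
    {N : Submodule R L} : (p : ℤ_[p]) ^ n • x ∈ (p : ℤ_[p]) ^ n • N ↔ x ∈ N := by
  refine ⟨?_, Submodule.smul_mem_pointwise_smul _ _ _⟩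
  rintro ⟨y, hy, hxy⟩
  rwa [← pow_p_smul_injective n hxy]

theorem pow_smul_le_pow_smul_iff [Module.IsTorsionFree ℤ_[p] L] {n : ℕ} {M N : Submodule R L} :
    (p : ℤ_[p]) ^ n • M ≤ (p : ℤ_[p]) ^ n • N ↔ M ≤ N :=
  ⟨fun h _ hx => pow_smul_mem_pow_smul_iff.1 (h (pow_smul_mem_pow_smul_iff.2 hx)),
    fun h => zp_smul_mono _ h⟩

theorem ideal_pow_zero_smul (I : Ideal R) (N : Submodule R L) : I ^ 0 • N = N := by
  rw [Submodule.pow_zero, Submodule.one_eq_span, ← Ideal.span, Ideal.span_singleton_one,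
    Submodule.top_smul]

theorem ideal_pow_succ_smul (I : Ideal R) (N : Submodule R L) (n : ℕ) :
    I ^ (n + 1) • N = I ^ n • (I • N) := by
  rw [Submodule.pow_succ, Submodule.mul_smul]

theorem ideal_pow_add_smul (I : Ideal R) (N : Submodule R L) (m n : ℕ) :
    I ^ (m + n) • N = I ^ m • (I ^ n • N) := by
  induction n generalizing N with
  | zero => rw [ideal_pow_zero_smul, add_zero]
  | succ n ih => rw [← add_assoc, ideal_pow_succ_smul, ideal_pow_succ_smul, ih]

theorem ideal_pow_succ_smul' (I : Ideal R) (N : Submodule R L) (n : ℕ) :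
    I ^ (n + 1) • N = I • (I ^ n • N) := by
  rw [add_comm, ideal_pow_add_smul, Submodule.pow_one]

theorem pow_smul_le_ideal_pow_smul {I : Ideal R} (hI : algebraMap ℤ_[p] R p ∈ I)
    (N : Submodule R L) (n : ℕ) : (p : ℤ_[p]) ^ n • N ≤ I ^ n • N := by
  induction n with
  | zero => rw [ideal_pow_zero_smul, pow_zero, one_smul]
  | succ n ih =>
    rw [ideal_pow_succ_smul', pow_succ', mul_smul]
    refine (zp_smul_mono _ ih).trans ?_
    rintro _ ⟨x, hx, rfl⟩
    show (p : ℤ_[p]) • x ∈ _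
    rw [← algebraMap_smul R]
    exact Submodule.smul_mem_smul hI hx

theorem ideal_pow_smul_antitone (I : Ideal R) (N : Submodule R L) :
    Antitone fun n : ℕ => I ^ n • N :=
  antitone_nat_of_succ_le fun n => by
    rw [ideal_pow_succ_smul']
    exact Submodule.smul_le_right

theorem ideal_pow_mul_smul_le {I : Ideal R} {E : Submodule R L} {a b : ℕ}
    (h : I ^ b • E ≤ (p : ℤ_[p]) ^ a • E) (n : ℕ) :
    I ^ (b * n) • E ≤ (p : ℤ_[p]) ^ (a * n) • E := by
  induction n with
  | zero => rw [mul_zero, mul_zero, ideal_pow_zero_smul, pow_zero, one_smul]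
  | succ n ih =>
    rw [mul_add_one, ideal_pow_add_smul]
    refine (Submodule.smul_mono le_rfl h).trans ?_
    rw [ideal_smul_zp_smul, mul_add_one, add_comm, pow_add, mul_smul]
    exact zp_smul_mono _ ih

variable [Module.Finite ℤ_[p] L]

instance finite_zp_submodule (M : Submodule R L) : Module.Finite ℤ_[p] M :=
  inferInstanceAs (Module.Finite ℤ_[p] (M.restrictScalars ℤ_[p]))

omit [Module.Finite ℤ_[p] L] in
variable (p R L) in
theorem isNoetherian_of_finite_zp [h : Module.Finite ℤ_[p] L] : IsNoetherian R L :=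
  isNoetherian_of_tower ℤ_[p] (inferInstance : IsNoetherian ℤ_[p] L)

theorem isTorsionFree_of_p_smul {Q : Type*} [AddCommGroup Q] [Module ℤ_[p] Q]
    (h : ∀ x : Q, (p : ℤ_[p]) • x = 0 → x = 0) : Module.IsTorsionFree ℤ_[p] Q := by
  have h' : ∀ (n : ℕ) (x : Q), (p : ℤ_[p]) ^ n • x = 0 → x = 0 := by
    intro n
    induction n with
    | zero => simp
    | succ n ih =>
      intro x hx
      rw [pow_succ', mul_smul] at hx
      exact ih x (h _ hx)
  refine Module.IsTorsionFree.of_smul_eq_zero fun a x hx => or_iff_not_imp_left.2 fun ha => ?_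
  rw [PadicInt.unitCoeff_spec ha, mul_smul] at hx
  exact h' _ _ ((PadicInt.unitCoeff ha).isUnit.smul_eq_zero.1 hx)

/-- The saturation of a submodule. -/
theorem exists_saturation (M : Submodule R L) :
    ∃ (M' : Submodule R L) (s : ℕ), M ≤ M' ∧ (p : ℤ_[p]) ^ s • M' ≤ M ∧
      Module.IsTorsionFree ℤ_[p] (L ⧸ M') := by
  -- The chain `{x | p ^ s x ∈ M}` stabilises because `L` is noetherian; its last term is the
  -- saturation.
  let K : ℕ →o Submodule R L :=
    { toFun := fun s => M.comap (DistribSMul.toLinearMap R L ((p : ℤ_[p]) ^ s))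
      monotone' := monotone_nat_of_le_succ fun n x hx => by
        show (p : ℤ_[p]) ^ (n + 1) • x ∈ M
        rw [pow_succ', mul_smul]
        exact zp_smul_mem M _ hx }
  have hK : ∀ n x, x ∈ K n ↔ (p : ℤ_[p]) ^ n • x ∈ M := fun n x => Iff.rfl
  obtain ⟨s, hs⟩ := monotone_stabilizes_iff_noetherian.mpr
    (isNoetherian_of_finite_zp p R L) K
  refine ⟨K s, s, fun x hx => zp_smul_mem M _ hx, ?_, ?_⟩
  · rintro _ ⟨x, hx, rfl⟩
    exact hx
  · refine isTorsionFree_of_p_smul fun x => ?_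
    obtain ⟨x, rfl⟩ := (K s).mkQ_surjective x
    intro hx
    have h1 : (p : ℤ_[p]) • x ∈ K s := (Submodule.Quotient.mk_eq_zero (K s)).1 hx
    have h2 : x ∈ K (s + 1) := by
      rw [hK] at h1 ⊢
      rwa [pow_succ, mul_smul]
    rw [← hs (s + 1) (Nat.le_succ s)] at h2
    exact (Submodule.Quotient.mk_eq_zero (K s)).2 h2

omit [Module.Finite ℤ_[p] L] in
theorem mem_of_pow_smul_mem {M : Submodule R L} [Module.IsTorsionFree ℤ_[p] (L ⧸ M)] {n : ℕ}
    {x : L} (h : (p : ℤ_[p]) ^ n • x ∈ M) : x ∈ M := by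
  rw [← Submodule.Quotient.mk_eq_zero] at h ⊢
  rw [Submodule.Quotient.mk_smul] at h
  exact (smul_eq_zero.1 h).resolve_left (pow_p_ne_zero n)

variable [Module.IsTorsionFree ℤ_[p] L]

theorem exists_linearMap_zmod_pow (p : ℕ) [Fact p.Prime] (L : Type*) [AddCommGroup L]
    [Module ℤ_[p] L] [Module.Finite ℤ_[p] L] [Module.IsTorsionFree ℤ_[p] L] (c : ℕ) :
    ∃ f : L →+ (Fin (Module.finrank ℤ_[p] L) → ZMod (p ^ c)),
      ∀ x, f x = 0 → ∃ w, x = (p : ℤ_[p]) ^ c • w := by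
  let b := Module.finBasis ℤ_[p] L
  refine ⟨{ toFun := fun x k => PadicInt.toZModPow c (b.equivFun x k)
            map_zero' := by ext; simp
            map_add' := fun x y => by ext; simp }, fun x hx => ?_⟩
  have h : ∀ k, ∃ a, b.equivFun x k = (p : ℤ_[p]) ^ c * a := fun k => by
    have h1 : b.equivFun x k ∈ RingHom.ker (PadicInt.toZModPow (p := p) c) := congrFun hx k
    rw [PadicInt.ker_toZModPow] at h1
    exact Ideal.mem_span_singleton.1 h1
  choose a ha using h
  refine ⟨b.equivFun.symm a, b.equivFun.injective ?_⟩
  rw [map_smul, LinearEquiv.apply_symm_apply]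
  exact funext ha

/-- Such a submodule is determined by its image in the finite group `(ℤ / p ^ c) ^ d`. -/
theorem finite_submodules_containing (c : ℕ) :
    {N : Submodule R L | (p : ℤ_[p]) ^ c • (⊤ : Submodule R L) ≤ N}.Finite := by
  obtain ⟨f, hf⟩ := exists_linearMap_zmod_pow p L c
  have : NeZero (p ^ c) := ⟨pow_ne_zero _ (Fact.out : p.Prime).ne_zero⟩
  refine Set.Finite.of_finite_image (f := fun N : Submodule R L => f '' N) (Set.toFinite _) ?_
  have key : ∀ M N : Submodule R L, (p : ℤ_[p]) ^ c • (⊤ : Submodule R L) ≤ N →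
      f '' M = f '' N → M ≤ N := by
    intro M N hN h x hx
    obtain ⟨y, hy, hxy⟩ : f x ∈ f '' N := h ▸ Set.mem_image_of_mem f hx
    obtain ⟨w, hw⟩ := hf (x - y) (by rw [map_sub, hxy, sub_self])
    rw [← sub_add_cancel x y, hw]
    exact N.add_mem (hN (pow_smul_mem_pow_smul_top c w)) hy
  intro M hM N hN h
  exact le_antisymm (key M N hN h) (key N M hM h.symm)

theorem eq_zero_of_forall_mem_pow_smul {x : L}
    (h : ∀ n : ℕ, ∃ y, x = (p : ℤ_[p]) ^ n • y) : x = 0 := by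
  let b := Module.finBasis ℤ_[p] L
  refine b.ext_elem fun k => ?_
  rw [map_zero, Finsupp.zero_apply]
  refine eq_zero_of_forall_pow_p_dvd fun n => ?_
  obtain ⟨y, rfl⟩ := h n
  exact ⟨b.repr y k, by simp⟩

/-- Dividing out the largest power of `p` leaves a primitive part `N`; pigeonhole is applied to
these parts. -/
theorem exists_eq_pow_smul {M : Submodule R L} (hM : M ≠ ⊥) :
    ∃ (u : ℕ) (N : Submodule R L), M = (p : ℤ_[p]) ^ u • N ∧
      ¬ N ≤ (p : ℤ_[p]) • (⊤ : Submodule R L) := by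
  classical
  have hex : ∃ u : ℕ, ¬ M ≤ (p : ℤ_[p]) ^ (u + 1) • (⊤ : Submodule R L) := by
    by_contra! h
    refine hM ((Submodule.eq_bot_iff _).2 fun x hx =>
      eq_zero_of_forall_mem_pow_smul (p := p) fun n => ?_)
    exact exists_of_mem_pow_smul_top (R := R)
      (pow_p_smul_le_pow_p_smul (Nat.le_succ n) _ (h n hx))
  have hle : M ≤ (p : ℤ_[p]) ^ Nat.find hex • (⊤ : Submodule R L) := by
    rcases Nat.eq_zero_or_pos (Nat.find hex) with h | h
    · rw [h]; simp
    · have := Nat.find_min hex (Nat.sub_one_lt h.ne')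
      rwa [not_not, Nat.sub_add_cancel h] at this
  have hMN : M = (p : ℤ_[p]) ^ Nat.find hex •
      M.comap (DistribSMul.toLinearMap R L ((p : ℤ_[p]) ^ Nat.find hex)) := by
    refine le_antisymm (fun x hx => ?_) ?_
    · obtain ⟨y, rfl⟩ := exists_of_mem_pow_smul_top (hle hx)
      exact Submodule.smul_mem_pointwise_smul _ _ _ hx
    · rintro _ ⟨x, hx, rfl⟩
      exact hx
  refine ⟨_, _, hMN, fun h => Nat.find_spec hex ?_⟩
  refine hMN.le.trans ?_
  rw [pow_succ, mul_smul]
  exact zp_smul_mono _ h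

omit [Module.Finite ℤ_[p] L] in
theorem ideal_pow_smul_top_ne_bot [Nontrivial L] {I : Ideal R} (hI : algebraMap ℤ_[p] R p ∈ I)
    (n : ℕ) : I ^ n • (⊤ : Submodule R L) ≠ ⊥ := by
  obtain ⟨x, hx⟩ := exists_ne (0 : L)
  intro h
  have h1 := pow_smul_le_ideal_pow_smul hI ⊤ n (pow_smul_mem_pow_smul_top (R := R) n x)
  rw [h, Submodule.mem_bot] at h1
  exact hx ((smul_eq_zero.1 h1).resolve_left (pow_p_ne_zero n))

/-- On an irreducible lattice the series `I ^ n L` is periodic up to scaling. -/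
theorem exists_ideal_pow_smul_eq_of_irreducible [Nontrivial L] {I : Ideal R}
    (hI : algebraMap ℤ_[p] R p ∈ I)
    (hirr : ∀ M : Submodule R L, M ≠ ⊥ → ∃ m : ℕ, (p : ℤ_[p]) ^ m • (⊤ : Submodule R L) ≤ M) :
    ∃ i b a : ℕ, 0 < b ∧
      I ^ (b + i) • (⊤ : Submodule R L) = (p : ℤ_[p]) ^ a • (I ^ i • (⊤ : Submodule R L)) := by
  obtain ⟨c, hc⟩ := exists_pow_smul_top_le_of_irreducible hirr
  choose u N hN hN' using fun n =>
    exists_eq_pow_smul (p := p) (ideal_pow_smul_top_ne_bot (L := L) hI n)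
  obtain ⟨i, -, j, -, hij, hNij⟩ := Set.infinite_univ.exists_lt_map_eq_of_mapsTo
    (f := N) (fun n _ => hc (N n) (hN' n)) (finite_submodules_containing c)
  -- Otherwise `I ^ j L ⊆ I ^ i L ⊆ p ^ (u j + 1) L`, which would force `N j ⊆ p L`.
  have hu : u i ≤ u j := by
    by_contra! hlt
    refine hN' j (pow_smul_le_pow_smul_iff (p := p) (n := u j) |>.1 ?_)
    rw [← hN, ← mul_smul, ← pow_succ]
    refine (ideal_pow_smul_antitone I ⊤ hij.le).trans ?_
    change I ^ i • ⊤ ≤ _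
    rw [hN i]
    exact (zp_smul_mono _ le_top).trans (pow_p_smul_le_pow_p_smul hlt _)
  refine ⟨i, j - i, u j - u i, Nat.sub_pos_of_lt hij, ?_⟩
  rw [Nat.sub_add_cancel hij.le, hN j, hN i, ← hNij, ← mul_smul, ← pow_add, Nat.sub_add_cancel hu]

end Lattices

/-! ### The slowest rate of a lattice -/

section Lattices

open scoped Pointwise

/-- `I ^ (b n) L` lies in `p ^ (a n) L` up to a bounded factor, witnessed by an open submodule `E`
with `I ^ b E ⊆ p ^ a E`, and this is optimal. -/
def HasMinimalSlope (p : ℕ) [Fact p.Prime] {R : Type*} [Ring R] (I : Ideal R)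
    (L : Type*) [AddCommGroup L] [Module ℤ_[p] L] [Module R L] [SMulCommClass ℤ_[p] R L]
    (a b : ℕ) : Prop :=
  (∃ (E : Submodule R L) (m : ℕ), (∀ x : L, (p : ℤ_[p]) ^ m • x ∈ E) ∧
    ∀ x ∈ I ^ b • E, ∃ y ∈ E, x = (p : ℤ_[p]) ^ a • y) ∧
  ∃ c : ℕ, ∀ n : ℕ, ∃ x ∈ I ^ (b * n) • (⊤ : Submodule R L),
    ∀ y : L, x ≠ (p : ℤ_[p]) ^ (a * n + c) • y

variable {p : ℕ} [Fact p.Prime] {R : Type*} [Ring R] [Algebra ℤ_[p] R] {I : Ideal R}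
  {L : Type*} [AddCommGroup L] [Module ℤ_[p] L] [Module R L] [IsScalarTower ℤ_[p] R L]

theorem mem_pow_smul_iff {n : ℕ} {x : L} {E : Submodule R L} :
    x ∈ (p : ℤ_[p]) ^ n • E ↔ ∃ y ∈ E, x = (p : ℤ_[p]) ^ n • y :=
  ⟨fun ⟨y, hy, h⟩ => ⟨y, hy, h.symm⟩, fun ⟨y, hy, h⟩ => ⟨y, hy, h.symm⟩⟩

theorem HasMinimalSlope.mul {a b : ℕ} (h : HasMinimalSlope p I L a b) (k : ℕ) :
    HasMinimalSlope p I L (a * k) (b * k) := by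
  obtain ⟨⟨E, m, hm, hE⟩, c, hc⟩ := h
  refine ⟨⟨E, m, hm, fun x hx => ?_⟩, c, fun n => ?_⟩
  · exact mem_pow_smul_iff.1
      (ideal_pow_mul_smul_le (p := p) (fun x hx => mem_pow_smul_iff.2 (hE x hx)) k hx)
  · rw [mul_assoc, mul_assoc]
    exact hc (k * n)

/-- The slower of the two rates governs the extension. Witnesses of slowness in `M` remain witnesses
in `L` because `M` is saturated; those in `L / M` are lifted. -/
theorem HasMinimalSlope.of_submodule_of_quotient {M : Submodule R L}
    [Module.IsTorsionFree ℤ_[p] (L ⧸ M)] {a₁ a₂ b : ℕ} (h₁ : HasMinimalSlope p I M a₁ b)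
    (h₂ : HasMinimalSlope p I (L ⧸ M) a₂ b) : HasMinimalSlope p I L (min a₁ a₂) b := by
  obtain ⟨⟨E₁, m₁, hm₁, hE₁⟩, c₁, hc₁⟩ := h₁
  obtain ⟨⟨E₂, m₂, hm₂, hE₂⟩, c₂, hc₂⟩ := h₂
  set a := min a₁ a₂ with ha
  -- `I ^ b` maps the preimage of `E₂` into `p ^ a` times itself, up to an error in `M`. The factor
  -- `p ^ (m₁ + a)` pushes this error into `p ^ a E₁`, since `p ^ m₁ M ⊆ E₁`.
  refine ⟨⟨E₁.map M.subtype ⊔ (p : ℤ_[p]) ^ (m₁ + a) • E₂.comap M.mkQ, m₂ + (m₁ + a),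
    ?_, ?_⟩, ?_⟩
  · intro x
    have h1 : (p : ℤ_[p]) ^ m₂ • x ∈ E₂.comap M.mkQ := hm₂ (M.mkQ x)
    refine Submodule.mem_sup_right ?_
    rw [add_comm m₂, pow_add _ (m₁ + a), mul_smul]
    exact Submodule.smul_mem_pointwise_smul _ ((p : ℤ_[p]) ^ (m₁ + a)) _ h1
  · have hM : (p : ℤ_[p]) ^ (m₁ + a) • M ≤ (p : ℤ_[p]) ^ a • E₁.map M.subtype := by
      rw [add_comm, pow_add, mul_smul]
      refine zp_smul_mono _ ?_
      rintro _ ⟨x, hx, rfl⟩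
      exact ⟨_, hm₁ ⟨x, hx⟩, rfl⟩
    have h1 : I ^ b • E₁.map M.subtype ≤ (p : ℤ_[p]) ^ a • E₁.map M.subtype := by
      rw [← Submodule.map_smul'']
      rintro _ ⟨x, hx, rfl⟩
      obtain ⟨y, hy, rfl⟩ := hE₁ x hx
      exact pow_p_smul_le_pow_p_smul (min_le_left _ _) _
        (Submodule.smul_mem_pointwise_smul _ _ _ ⟨y, hy, rfl⟩)
    have h2 : I ^ b • E₂.comap M.mkQ ≤ (p : ℤ_[p]) ^ a • E₂.comap M.mkQ ⊔ M := by
      intro x hx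
      have hx' : M.mkQ x ∈ I ^ b • E₂ := Submodule.smul_comap_le_comap_smul M.mkQ E₂ (I ^ b) hx
      obtain ⟨y, hy, hxy⟩ := hE₂ _ hx'
      obtain ⟨z, rfl⟩ := M.mkQ_surjective y
      rw [← add_sub_cancel ((p : ℤ_[p]) ^ a₂ • z) x]
      refine Submodule.add_mem_sup (pow_p_smul_le_pow_p_smul (min_le_right _ _) _
        (Submodule.smul_mem_pointwise_smul _ _ _ hy)) ?_
      rw [← Submodule.Quotient.mk_eq_zero, Submodule.Quotient.mk_sub, sub_eq_zero]
      exact hxy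
    intro x hx
    refine mem_pow_smul_iff.1 ?_
    rw [Submodule.smul_sup, ideal_smul_zp_smul] at hx
    rw [Submodule.smul_sup']
    refine sup_le (h1.trans le_sup_left) ?_ hx
    refine (zp_smul_mono _ h2).trans ?_
    rw [Submodule.smul_sup', smul_comm]
    exact sup_le le_sup_right (hM.trans le_sup_left)
  · rcases min_choice a₁ a₂ with h | h
    · refine ⟨c₁, fun n => ?_⟩
      obtain ⟨x, hx, hx'⟩ := hc₁ n
      rw [ha, h]
      refine ⟨x, ?_, fun y hy => ?_⟩
      · exact Submodule.smul_mono le_rfl le_top ((Submodule.mem_smul_top_iff _ _ _).1 hx)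
      · exact hx' ⟨y, mem_of_pow_smul_mem (hy ▸ x.2)⟩ (Subtype.ext hy)
    · refine ⟨c₂, fun n => ?_⟩
      obtain ⟨x, hx, hx'⟩ := hc₂ n
      rw [ha, h]
      have hmap : (I ^ (b * n) • (⊤ : Submodule R L)).map M.mkQ = I ^ (b * n) • ⊤ := by
        rw [Submodule.map_smul'', Submodule.map_top, Submodule.range_mkQ]
      rw [← hmap] at hx
      obtain ⟨z, hz, rfl⟩ := hx
      exact ⟨z, hz, fun y hy => hx' (M.mkQ y) (congrArg M.mkQ hy)⟩

variable [Module.Finite ℤ_[p] L] [Module.IsTorsionFree ℤ_[p] L]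

theorem hasMinimalSlope_of_irreducible [Nontrivial L] (hI : algebraMap ℤ_[p] R p ∈ I)
    (hirr : ∀ M : Submodule R L, M ≠ ⊥ → ∃ m : ℕ, (p : ℤ_[p]) ^ m • (⊤ : Submodule R L) ≤ M) :
    ∃ a b : ℕ, 0 < b ∧ HasMinimalSlope p I L a b := by
  obtain ⟨i, b, a, hb, h⟩ := exists_ideal_pow_smul_eq_of_irreducible (p := p) (L := L) hI hirr
  obtain ⟨x, hx⟩ := exists_ne (0 : L)
  have hx0 : ∃ k, ∀ y : L, (p : ℤ_[p]) ^ i • x ≠ (p : ℤ_[p]) ^ k • y := by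
    by_contra! hcon
    have := eq_zero_of_forall_mem_pow_smul (p := p) hcon
    exact hx ((smul_eq_zero.1 this).resolve_left (pow_p_ne_zero i))
  obtain ⟨c, hc⟩ := hx0
  have hn : ∀ n, I ^ (b * n) • (I ^ i • (⊤ : Submodule R L)) =
      (p : ℤ_[p]) ^ (a * n) • (I ^ i • (⊤ : Submodule R L)) := by
    intro n
    induction n with
    | zero => rw [mul_zero, mul_zero, ideal_pow_zero_smul, pow_zero, one_smul]
    | succ n ih =>
      rw [mul_add_one, ideal_pow_add_smul, ← ideal_pow_add_smul I ⊤ b i, h, ideal_smul_zp_smul, ih,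
        mul_add_one, add_comm (a * n), pow_add, mul_smul]
  refine ⟨a, b, hb, ⟨I ^ i • ⊤, i, fun x => pow_smul_le_ideal_pow_smul hI ⊤ i
    (pow_smul_mem_pow_smul_top i x), fun x hx => ?_⟩, c, fun n => ?_⟩
  · rw [← ideal_pow_add_smul, h] at hx
    exact mem_pow_smul_iff.1 hx
  · refine ⟨(p : ℤ_[p]) ^ (a * n) • (p : ℤ_[p]) ^ i • x, ?_, fun y hy => ?_⟩
    · refine Submodule.smul_mono le_rfl le_top ((hn n).ge ?_)
      exact Submodule.smul_mem_pointwise_smul _ _ _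
        (pow_smul_le_ideal_pow_smul hI ⊤ i (pow_smul_mem_pow_smul_top i x))
    · rw [pow_add, mul_smul] at hy
      exact hc y (pow_p_smul_injective _ hy)

theorem finrank_pos_of_nontrivial [Nontrivial L] : 0 < Module.finrank ℤ_[p] L := Module.finrank_pos

omit [Module.IsTorsionFree ℤ_[p] L] in
theorem finrank_quotient_add (M : Submodule R L) :
    Module.finrank ℤ_[p] (L ⧸ M) + Module.finrank ℤ_[p] M = Module.finrank ℤ_[p] L :=
  Submodule.finrank_quotient_add_finrank (M.restrictScalars ℤ_[p])

theorem exists_hasMinimalSlope (hI : algebraMap ℤ_[p] R p ∈ I) (n : ℕ) :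
    ∀ (L : Type*) [AddCommGroup L] [Module ℤ_[p] L] [Module R L] [IsScalarTower ℤ_[p] R L]
      [Module.Finite ℤ_[p] L] [Module.IsTorsionFree ℤ_[p] L] [Nontrivial L],
      Module.finrank ℤ_[p] L = n → ∃ a b : ℕ, 0 < b ∧ HasMinimalSlope p I L a b := by
  induction n using Nat.strong_induction_on with
  | _ n ih =>
    intro L _ _ _ _ _ _ _ hn
    by_cases hirr : ∀ M : Submodule R L, M ≠ ⊥ →
        ∃ m : ℕ, (p : ℤ_[p]) ^ m • (⊤ : Submodule R L) ≤ M
    · exact hasMinimalSlope_of_irreducible hI hirr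
    · push Not at hirr
      obtain ⟨M₀, hM₀, hM₀'⟩ := hirr
      obtain ⟨M, s, hM, hs, htf⟩ := exists_saturation (p := p) M₀
      have : Nontrivial M := Submodule.nontrivial_iff_ne_bot.2 fun h => hM₀ (by simpa [h] using hM)
      have : Nontrivial (L ⧸ M) := Submodule.Quotient.nontrivial_iff.2 fun h => hM₀' s (h ▸ hs)
      have h1 := finrank_quotient_add (p := p) M
      have h2 := finrank_pos_of_nontrivial (p := p) (L := M)
      have h3 := finrank_pos_of_nontrivial (p := p) (L := L ⧸ M)
      obtain ⟨a₁, b₁, hb₁, H₁⟩ := ih _ (by omega) M rfl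
      obtain ⟨a₂, b₂, hb₂, H₂⟩ := ih _ (by omega) (L ⧸ M) rfl
      -- Both rates are brought to the common denominator `b₁ b₂`.
      exact ⟨min (a₁ * b₂) (a₂ * b₁), b₁ * b₂, Nat.mul_pos hb₁ hb₂,
        (H₁.mul b₂).of_submodule_of_quotient (mul_comm b₁ b₂ ▸ H₂.mul b₁)⟩

end Lattices

/-! ### A submodule realising the slowest rate -/

section Lattices

open scoped Pointwise

variable {p : ℕ} [Fact p.Prime] {R : Type*} [Ring R] [Algebra ℤ_[p] R] {I : Ideal R}
  {L : Type*} [AddCommGroup L] [Module ℤ_[p] L] [Module R L] [IsScalarTower ℤ_[p] R L]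
  [Module.Finite ℤ_[p] L] [Module.IsTorsionFree ℤ_[p] L]

/-- By compactness, open submodules that are not contained in a common `p ^ c L` and form a
descending chain have a nonzero intersection. -/
theorem exists_ne_zero_mem_of_antitone {F : ℕ → Submodule R L} (hF : Antitone F)
    (hopen : ∀ n, ∃ m : ℕ, (p : ℤ_[p]) ^ m • (⊤ : Submodule R L) ≤ F n) {c : ℕ}
    (hc : ∀ n, ∃ x ∈ F n, ∀ y : L, x ≠ (p : ℤ_[p]) ^ c • y) : ∃ z ≠ 0, ∀ n, z ∈ F n := by
  choose y hy hyc using hc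
  obtain ⟨z, hz⟩ := exists_frequently_sub_eq_pow_smul (p := p) y
  refine ⟨z, ?_, fun n => ?_⟩
  · rintro rfl
    obtain ⟨n, -, w, hw⟩ := hz c 0
    exact hyc n w (by rwa [sub_zero] at hw)
  · obtain ⟨m, hm⟩ := hopen n
    obtain ⟨k, hk, w, hw⟩ := hz m n
    rw [← sub_sub_cancel (y k) z, hw]
    exact (F n).sub_mem (hF hk (hy k)) (hm (pow_smul_mem_pow_smul_top m w))

/-- The rescaled terms `p ^ (-a n) I ^ (b n) E` descend because `I ^ b E ⊆ p ^ a E`. By optimality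
of the slope they do not shrink to zero, so their intersection is nonzero; `M` is its saturation. -/
theorem HasMinimalSlope.exists_submodule {a b : ℕ} (hI : algebraMap ℤ_[p] R p ∈ I)
    (h : HasMinimalSlope p I L a b) :
    ∃ (M : Submodule R L) (c : ℕ), M ≠ ⊥ ∧ Module.IsTorsionFree ℤ_[p] (L ⧸ M) ∧
      ∀ n, (∀ x ∈ I ^ (b * n) • (⊤ : Submodule R L),
          ∃ y : L, (p : ℤ_[p]) ^ c • x = (p : ℤ_[p]) ^ (a * n) • y) ∧
        ∀ x ∈ M, (p : ℤ_[p]) ^ (a * n + c) • x ∈ I ^ (b * n) • (⊤ : Submodule R L) := by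
  obtain ⟨⟨E, m, hm, hE⟩, c, hc⟩ := h
  have hE' : I ^ b • E ≤ (p : ℤ_[p]) ^ a • E := fun x hx => mem_pow_smul_iff.2 (hE x hx)
  have hm' : (p : ℤ_[p]) ^ m • (⊤ : Submodule R L) ≤ E := by
    rintro _ ⟨x, -, rfl⟩
    exact hm x
  have hmul : ∀ n, (p : ℤ_[p]) ^ m • (I ^ (b * n) • (⊤ : Submodule R L)) ≤ I ^ (b * n) • E :=
    fun n => by
      rw [← ideal_smul_zp_smul]
      exact Submodule.smul_mono le_rfl hm'
  let F : ℕ → Submodule R L := fun n =>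
    (I ^ (b * n) • E).comap (DistribSMul.toLinearMap R L ((p : ℤ_[p]) ^ (a * n)))
  have hF : ∀ n x, x ∈ F n ↔ (p : ℤ_[p]) ^ (a * n) • x ∈ I ^ (b * n) • E := fun n x => Iff.rfl
  have hanti : Antitone F := by
    refine antitone_nat_of_succ_le fun n x hx => ?_
    rw [hF, mul_add_one, mul_add_one, ideal_pow_add_smul, add_comm, pow_add, mul_smul] at hx
    have h1 := Submodule.smul_mono (le_refl (I ^ (b * n))) hE' hx
    rw [ideal_smul_zp_smul] at h1
    exact (hF n x).2 (pow_smul_mem_pow_smul_iff.1 h1)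
  obtain ⟨z, hz0, hz⟩ := exists_ne_zero_mem_of_antitone (p := p) (c := c + m) hanti
    (fun n => ⟨b * n + m, by
      rintro _ ⟨x, -, rfl⟩
      have h1 : (p : ℤ_[p]) ^ (b * n + m) • x ∈ (p : ℤ_[p]) ^ (b * n) • E := by
        rw [pow_add, mul_smul]
        exact Submodule.smul_mem_pointwise_smul _ _ _ (hm x)
      exact (hF n _).2 (zp_smul_mem _ _ (pow_smul_le_ideal_pow_smul hI E _ h1))⟩)
    (fun n => by
      obtain ⟨x, hx, hx'⟩ := hc n
      have h1 := hmul n (Submodule.smul_mem_pointwise_smul _ ((p : ℤ_[p]) ^ m) _ hx)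
      obtain ⟨y, -, hy⟩ := mem_pow_smul_iff.1 (ideal_pow_mul_smul_le hE' n h1)
      refine ⟨y, (hF n y).2 (hy ▸ h1), fun w hw => hx' w (pow_p_smul_injective (p := p) m ?_)⟩
      simp only
      rw [hy, hw, smul_smul, smul_smul, ← pow_add, ← pow_add]
      congr 2
      ring)
  obtain ⟨M, s, hM, hs, htf⟩ := exists_saturation (p := p) (⨅ n, F n)
  refine ⟨M, s + m, ?_, htf, fun n => ⟨fun x hx => ?_, fun x hx => ?_⟩⟩
  · rintro rfl
    exact hz0 ((Submodule.mem_bot R).1 (hM ((Submodule.mem_iInf _).2 hz)))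
  · obtain ⟨y, -, hy⟩ := mem_pow_smul_iff.1 (ideal_pow_mul_smul_le hE' n
      (hmul n (Submodule.smul_mem_pointwise_smul _ _ _ hx)))
    refine ⟨(p : ℤ_[p]) ^ s • y, ?_⟩
    rw [pow_add, mul_smul, hy, smul_comm]
  · have h1 := (Submodule.mem_iInf _).1 (hs (Submodule.smul_mem_pointwise_smul _ _ _ hx)) n
    rw [hF, smul_smul, ← pow_add] at h1
    rw [← add_assoc, add_comm, pow_add, mul_smul]
    exact zp_smul_mem _ _ (Submodule.smul_mono le_rfl le_top h1)

/-- A nonzero lattice contains a nonzero saturated submodule on which the series `I ^ i L` shrinks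
at the slowest, rational, rate. -/
theorem exists_slowest_submodule [Nontrivial L] (hI : algebraMap ℤ_[p] R p ∈ I) :
    ∃ (ξ : ℝ) (M : Submodule R L) (c : ℕ), (∃ q : ℚ, ξ = q) ∧ M ≠ ⊥ ∧
      Module.IsTorsionFree ℤ_[p] (L ⧸ M) ∧
      ∀ i : ℕ, (∀ x ∈ I ^ i • (⊤ : Submodule R L),
          ∃ y : L, (p : ℤ_[p]) ^ c • x = (p : ℤ_[p]) ^ ⌊(i : ℝ) * ξ⌋₊ • y) ∧
        ∀ x ∈ M, (p : ℤ_[p]) ^ (⌊(i : ℝ) * ξ⌋₊ + c) • x ∈ I ^ i • (⊤ : Submodule R L) := by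
  obtain ⟨a, b, hb, h⟩ := exists_hasMinimalSlope hI _ L rfl
  obtain ⟨M, c, hM, htf, hc⟩ := h.exists_submodule hI
  -- The extra `a` pays for rounding `i` down or up to a multiple of `b`.
  refine ⟨(a : ℝ) / b, M, c + a, ⟨(a : ℚ) / b, by push_cast; rfl⟩, hM, htf, fun i => ?_⟩
  have hfl : ⌊(i : ℝ) * ((a : ℝ) / b)⌋₊ = i * a / b := by
    rw [← mul_div_assoc, ← Nat.cast_mul, Nat.floor_div_eq_div]
  rw [hfl]
  have hi : b * (i / b) ≤ i := Nat.mul_div_le i b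
  have hi' : i ≤ b * (i / b + 1) := (Nat.lt_mul_div_succ i hb).le
  have h1 : a * (i / b) ≤ i * a / b := by
    rw [Nat.le_div_iff_mul_le hb]
    nlinarith
  have h2 : i * a / b ≤ a * (i / b) + a := by
    refine Nat.div_le_of_le_mul ?_
    nlinarith
  refine ⟨fun x hx => ?_, fun x hx => ?_⟩
  · obtain ⟨y, hy⟩ := (hc (i / b)).1 x (ideal_pow_smul_antitone I ⊤ hi hx)
    obtain ⟨k, hk⟩ := Nat.exists_eq_add_of_le h2
    refine ⟨(p : ℤ_[p]) ^ k • y, ?_⟩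
    rw [add_comm, pow_add, mul_smul, hy, smul_smul, smul_smul, ← pow_add, ← pow_add, ← hk, add_comm]
  · have h3 := ideal_pow_smul_antitone I ⊤ hi' ((hc (i / b + 1)).2 x hx)
    obtain ⟨k, hk⟩ := Nat.exists_eq_add_of_le h1
    have h4 : i * a / b + (c + a) = k + (a * (i / b + 1) + c) := by rw [hk]; ring
    rw [h4, pow_add, mul_smul]
    exact zp_smul_mem _ _ h3

end Lattices

/-! ### Growth in coordinates: uniqueness and existence -/

section Lattices

open scoped Pointwise

section Strata

variable {p : ℕ} [Fact p.Prime] {L : Type*} [AddCommGroup L] [Module ℤ_[p] L]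

/-- Coordinatewise form of an equivalence between `S` and `⨁ k, p ^ ⌊i ξ k⌋ ℤ_p x k`. -/
def HasGrowth {ι : Type*} (S : ℕ → Submodule ℤ_[p] L) (x : Module.Basis ι ℤ_[p] L) (ξ : ι → ℝ) :
    Prop :=
  ∃ c : ℕ, ∀ i : ℕ, 1 ≤ i →
    (∀ y ∈ S i, ∀ k, (p : ℤ_[p]) ^ ⌊(i : ℝ) * ξ k⌋₊ ∣ (p : ℤ_[p]) ^ c * x.repr y k) ∧
    ∀ k, (p : ℤ_[p]) ^ (⌊(i : ℝ) * ξ k⌋₊ + c) • x k ∈ S i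

theorem mem_stratum_iff {d : ℕ} {x : Module.Basis (Fin d) ℤ_[p] L} {ξ : Fin d → ℝ} {i : ℕ}
    {y : L} : y ∈ stratum p x ξ i ↔ ∀ k, (p : ℤ_[p]) ^ ⌊(i : ℝ) * ξ k⌋₊ ∣ x.repr y k := by
  constructor
  · intro hy k
    refine Submodule.span_induction (p := fun y _ => (p : ℤ_[p]) ^ ⌊(i : ℝ) * ξ k⌋₊ ∣ x.repr y k)
      ?_ ?_ ?_ ?_ hy
    · rintro _ ⟨j, rfl⟩
      rcases eq_or_ne j k with rfl | h
      · simp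
      · simp [h]
    · simp
    · intro y z _ _ hy hz
      simpa using dvd_add hy hz
    · intro a y _ hy
      simpa using hy.mul_left a
  · intro h
    rw [← x.sum_repr y]
    refine Submodule.sum_mem _ fun k _ => ?_
    obtain ⟨a, ha⟩ := h k
    rw [ha, mul_comm, mul_smul]
    exact Submodule.smul_mem _ _ (Submodule.subset_span ⟨k, rfl⟩)

theorem exists_cEquivalent_iff {d : ℕ} {S : ℕ → Submodule ℤ_[p] L}
    {x : Module.Basis (Fin d) ℤ_[p] L} {ξ : Fin d → ℝ} :
    (∃ c, CEquivalent p c S (stratum p x ξ)) ↔ HasGrowth S x ξ := by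
  refine exists_congr fun c => forall₂_congr fun i _ => and_congr ?_ ⟨fun h k => ?_, fun h y hy => ?_⟩
  · simp_rw [mem_stratum_iff, map_smul, Finsupp.smul_apply, smul_eq_mul]
  · rw [add_comm, pow_add, mul_smul]
    exact h _ (Submodule.subset_span ⟨k, rfl⟩)
  · refine Submodule.span_induction (p := fun y _ => (p : ℤ_[p]) ^ c • y ∈ S i) ?_ ?_ ?_ ?_ hy
    · rintro _ ⟨k, rfl⟩
      simp only
      rw [smul_smul, ← pow_add, add_comm]
      exact h k
    · simp
    · intro y z _ _ hy hz
      rw [smul_add]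
      exact add_mem hy hz
    · intro a y _ hy
      rw [smul_comm]
      exact Submodule.smul_mem _ _ hy

theorem HasGrowth.reindex {ι κ : Type*} {S : ℕ → Submodule ℤ_[p] L} {x : Module.Basis ι ℤ_[p] L}
    {ξ : ι → ℝ} (h : HasGrowth S x ξ) (e : ι ≃ κ) : HasGrowth S (x.reindex e) (ξ ∘ e.symm) := by
  obtain ⟨c, hc⟩ := h
  refine ⟨c, fun i hi => ⟨fun y hy k => ?_, fun k => ?_⟩⟩
  · simpa using (hc i hi).1 y hy (e.symm k)
  · simpa using (hc i hi).2 (e.symm k)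

theorem le_of_floor_mul_le_add {α β : ℝ} (hβ : 0 ≤ β) {C : ℕ}
    (h : ∀ i : ℕ, 1 ≤ i → ⌊(i : ℝ) * α⌋₊ ≤ ⌊(i : ℝ) * β⌋₊ + C) : α ≤ β := by
  by_contra! hlt
  obtain ⟨n, hn⟩ := exists_nat_gt ((C + 1 : ℝ) / (α - β))
  rw [div_lt_iff₀ (sub_pos.2 hlt)] at hn
  have hn1 : 1 ≤ n := by
    rcases Nat.eq_zero_or_pos n with rfl | h0
    · have : (0 : ℝ) ≤ C := Nat.cast_nonneg C
      norm_num at hn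
      linarith
    · exact h0
  have h1 := Nat.lt_floor_add_one ((n : ℝ) * α)
  have h2 : ((⌊(n : ℝ) * α⌋₊ : ℕ) : ℝ) ≤ (⌊(n : ℝ) * β⌋₊ : ℕ) + C := mod_cast h n hn1
  have h3 := Nat.floor_le (mul_nonneg (Nat.cast_nonneg n) hβ)
  linarith

theorem le_of_pow_dvd_pow {m n : ℕ} (h : (p : ℤ_[p]) ^ m ∣ (p : ℤ_[p]) ^ n) : m ≤ n :=
  (pow_dvd_pow_iff PadicInt.prime_p.ne_zero PadicInt.prime_p.not_isUnit).1 h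

/-- A linear map preserving the series has no matrix entries from slow to fast directions. -/
theorem HasGrowth.repr_apply_eq_zero {ι κ : Type*} {S : ℕ → Submodule ℤ_[p] L}
    {x : Module.Basis ι ℤ_[p] L} {y : Module.Basis κ ℤ_[p] L} {ξ : ι → ℝ} {η : κ → ℝ}
    (hx : HasGrowth S x ξ) (hy : HasGrowth S y η) (hξ : ∀ k, 0 ≤ ξ k) (f : L →ₗ[ℤ_[p]] L)
    (hf : ∀ i, ∀ z ∈ S i, f z ∈ S i) {k : ι} {j : κ} (hkj : ξ k < η j) :
    y.repr (f (x k)) j = 0 := by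
  obtain ⟨c, hc⟩ := hx
  obtain ⟨c', hc'⟩ := hy
  by_contra hne
  -- A nonzero entry has a fixed finite valuation, which cannot absorb the linearly growing gap
  -- between the two rates.
  refine hkj.not_ge (le_of_floor_mul_le_add (C := c + c' + (y.repr (f (x k)) j).valuation)
    (hξ k) fun i hi => ?_)
  have h1 := (hc' i hi).1 _ (hf i _ ((hc i hi).2 k)) j
  rw [map_smul, map_smul, Finsupp.smul_apply, smul_eq_mul, PadicInt.unitCoeff_spec hne] at h1
  have h2 : (p : ℤ_[p]) ^ ⌊(i : ℝ) * η j⌋₊ ∣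
      (p : ℤ_[p]) ^ (⌊(i : ℝ) * ξ k⌋₊ + (c + c' + (y.repr (f (x k)) j).valuation)) := by
    rw [← (PadicInt.unitCoeff hne).isUnit.dvd_mul_left]
    convert h1 using 1
    ring
  exact le_of_pow_dvd_pow h2

/-- If `ξ k < η k`, the identity has no entries from `x 0, …, x k` to `y k, y (k + 1), …`. Then `k +
1` independent vectors would lie in the span of the `k` vectors `y 0, …, y (k - 1)`. -/
theorem HasGrowth.le_of_monotone {d : ℕ} {S : ℕ → Submodule ℤ_[p] L}
    {x y : Module.Basis (Fin d) ℤ_[p] L} {ξ η : Fin d → ℝ}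
    (hx : HasGrowth S x ξ) (hy : HasGrowth S y η) (hξ : ∀ k, 0 ≤ ξ k) (hξm : Monotone ξ)
    (hηm : Monotone η) (k : Fin d) : η k ≤ ξ k := by
  by_contra! hlt
  have h0 : ∀ j l : Fin d, j ≤ k → k ≤ l → y.repr (x j) l = 0 := fun j l hj hl =>
    hx.repr_apply_eq_zero hy hξ LinearMap.id (fun _ _ h => h)
      (((hξm hj).trans_lt hlt).trans_le (hηm hl))
  let f : (Fin k.1.succ → ℤ_[p]) →ₗ[ℤ_[p]] (Fin k → ℤ_[p]) :=
    LinearMap.pi (fun l : Fin k => y.coord (l.castLE k.2.le)) ∘ₗ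
      Fintype.linearCombination ℤ_[p] fun j : Fin k.1.succ => x (j.castLE k.2)
  have hf : Function.Injective f := by
    rw [← LinearMap.ker_eq_bot, LinearMap.ker_eq_bot']
    intro a ha
    have hli : LinearIndependent ℤ_[p] fun j : Fin k.1.succ => x (j.castLE k.2) :=
      x.linearIndependent.comp _ (Fin.castLE_injective _)
    have hz : ∑ j, a j • x (Fin.castLE k.2 j) = 0 := by
      refine y.ext_elem fun l => ?_
      rw [map_zero, Finsupp.zero_apply]
      rcases lt_or_ge l k with hl | hl
      · have := congrFun ha ⟨l, hl⟩
        simpa [f, Fintype.linearCombination_apply] using this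
      · rw [map_sum, Finsupp.finsetSum_apply]
        refine Finset.sum_eq_zero fun j _ => ?_
        rw [map_smul, Finsupp.smul_apply, h0 _ _ (Fin.le_def.2 (Nat.lt_succ_iff.1 j.2)) hl,
          smul_zero]
    exact funext (Fintype.linearIndependent_iff.1 hli a hz)
  have := LinearMap.finrank_le_finrank_of_injective hf
  simp at this

end Strata

variable {p : ℕ} [Fact p.Prime] {R : Type*} [Ring R] [Algebra ℤ_[p] R] {I : Ideal R}

theorem exists_hasGrowth (hI : algebraMap ℤ_[p] R p ∈ I) (n : ℕ) :
    ∀ (L : Type*) [AddCommGroup L] [Module ℤ_[p] L] [Module R L] [IsScalarTower ℤ_[p] R L]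
      [Module.Finite ℤ_[p] L] [Module.IsTorsionFree ℤ_[p] L], Module.finrank ℤ_[p] L = n →
      ∃ (ι : Type) (x : Module.Basis ι ℤ_[p] L) (ξ : ι → ℝ), Finite ι ∧
        (∀ k, ∃ q : ℚ, ξ k = q) ∧
        HasGrowth (fun i => (I ^ i • (⊤ : Submodule R L)).restrictScalars ℤ_[p]) x ξ := by
  induction n using Nat.strong_induction_on with
  | _ n ih =>
    intro L _ _ _ _ _ _ hn
    rcases subsingleton_or_nontrivial L with hL | hL
    · refine ⟨Empty, Module.Basis.empty L, Empty.elim, inferInstance, fun k => k.elim, 0,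
        fun i _ => ⟨fun _ _ k => k.elim, fun k => k.elim⟩⟩
    obtain ⟨ρ, M, c, hρ, hM, htf, hc⟩ := exists_slowest_submodule (L := L) hI
    have : Nontrivial M := Submodule.nontrivial_iff_ne_bot.2 hM
    have h1 := finrank_quotient_add (p := p) M
    have h2 := finrank_pos_of_nontrivial (p := p) (L := M)
    obtain ⟨ι, x, ξ, hι, hξ, c', hc'⟩ := ih _ (by omega) (L ⧸ M) rfl
    let e : (L ⧸ M.restrictScalars ℤ_[p]) ≃ₗ[ℤ_[p]] L ⧸ M :=
      Submodule.Quotient.restrictScalarsEquiv ℤ_[p] M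
    have he : ∀ z : L, e (Submodule.Quotient.mk z) = M.mkQ z := fun z => rfl
    let w : Module.Basis (Fin (Module.finrank ℤ_[p] M)) ℤ_[p] (M.restrictScalars ℤ_[p]) :=
      Module.finBasis ℤ_[p] M
    -- A basis of `M` followed by lifts of the frame of `L / M`. The rates need not be sorted here.
    let b := w.sumQuot (x.map e.symm)
    have hmap : ∀ i, (I ^ i • (⊤ : Submodule R L)).map M.mkQ = I ^ i • ⊤ := fun i => by
      rw [Submodule.map_smul'', Submodule.map_top, Submodule.range_mkQ]
    refine ⟨_, b, Sum.elim (fun _ => ρ) ξ, inferInstance, Sum.forall.2 ⟨fun _ => hρ, hξ⟩,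
      2 * c + c', fun i hi => ⟨fun y hy => Sum.forall.2 ⟨fun k => ?_, fun k => ?_⟩,
        Sum.forall.2 ⟨fun k => ?_, fun k => ?_⟩⟩⟩
    · obtain ⟨z, hz⟩ := (hc i).1 y hy
      have h3 : (p : ℤ_[p]) ^ c * b.repr y (Sum.inl k) =
          (p : ℤ_[p]) ^ ⌊(i : ℝ) * ρ⌋₊ * b.repr z (Sum.inl k) := by
        simpa using congrArg (fun u => b.repr u (Sum.inl k)) hz
      rw [show 2 * c + c' = (c + c') + c by ring, pow_add, mul_assoc, h3]
      exact (dvd_mul_right _ _).mul_left _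
    · have h3 := (hc' i hi).1 (M.mkQ y) ((hmap i).le (Submodule.mem_map_of_mem hy)) k
      have h4 : b.repr y (Sum.inr k) = x.repr (M.mkQ y) k := by
        simp only [b, Module.Basis.sumQuot_repr_inr]
        rfl
      rw [h4, pow_add, mul_assoc]
      exact h3.mul_left _
    · have h3 : (p : ℤ_[p]) ^ (⌊(i : ℝ) * ρ⌋₊ + c) • b (Sum.inl k) ∈
          I ^ i • (⊤ : Submodule R L) := (hc i).2 _ (by
        rw [Module.Basis.sumQuot_inl]
        exact (w k).2)
      show (p : ℤ_[p]) ^ (⌊(i : ℝ) * ρ⌋₊ + (2 * c + c')) • b (Sum.inl k) ∈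
          I ^ i • (⊤ : Submodule R L)
      rw [show ⌊(i : ℝ) * ρ⌋₊ + (2 * c + c') = (c + c') + (⌊(i : ℝ) * ρ⌋₊ + c) by ring, pow_add,
        mul_smul]
      exact zp_smul_mem _ _ h3
    · have hz : M.mkQ (b (Sum.inr k)) = x k := by
        rw [← he, Module.Basis.sumQuot_inr, Module.Basis.map_apply, LinearEquiv.apply_symm_apply]
      show (p : ℤ_[p]) ^ (⌊(i : ℝ) * ξ k⌋₊ + (2 * c + c')) • b (Sum.inr k) ∈
          I ^ i • (⊤ : Submodule R L)
      generalize b (Sum.inr k) = z at hz ⊢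
      have h3 : (p : ℤ_[p]) ^ (⌊(i : ℝ) * ξ k⌋₊ + c') • x k ∈ I ^ i • (⊤ : Submodule R (L ⧸ M)) :=
        (hc' i hi).2 k
      rw [← hmap] at h3
      obtain ⟨v, hv, hvz⟩ := h3
      obtain ⟨y, hy⟩ := (hc i).1 v hv
      generalize ⌊(i : ℝ) * ξ k⌋₊ = F at hvz ⊢
      generalize hf : ⌊(i : ℝ) * ρ⌋₊ = f at hy
      -- The quotient direction is no slower than `ρ`, up to a constant: `p ^ c v` is divisible by
      -- `p ^ f`, and the image of `v` is `p ^ (F + c') x k`.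
      have hfF : f ≤ c + (F + c') := by
        have h4 : (p : ℤ_[p]) ^ (c + (F + c')) • x k = (p : ℤ_[p]) ^ f • M.mkQ y := by
          rw [pow_add, mul_smul, ← hvz]
          exact congrArg M.mkQ hy
        have h5 := congrArg (fun u => x.repr u k) h4
        simp only [map_smul, Finsupp.smul_apply, Module.Basis.repr_self, Finsupp.single_eq_same,
          smul_eq_mul, mul_one] at h5
        exact le_of_pow_dvd_pow ⟨_, h5⟩
      obtain ⟨g, hg⟩ := Nat.exists_eq_add_of_le hfF
      have h6 : (p : ℤ_[p]) ^ f • (y - (p : ℤ_[p]) ^ g • z) =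
          (p : ℤ_[p]) ^ c • (v - (p : ℤ_[p]) ^ (F + c') • z) := by
        rw [smul_sub, smul_sub, hy, smul_smul, smul_smul, ← pow_add, ← pow_add, hg]
      -- The error `v - p ^ (F + c') z` lies in `M`, and `p ^ c` times it is `p ^ f` times an
      -- element of `M` by saturation. A further `p ^ c` puts it in `I ^ i L`, whence the constant
      -- `2 c + c'`.
      have h7 : y - (p : ℤ_[p]) ^ g • z ∈ M := by
        refine mem_of_pow_smul_mem (p := p) (n := f) ?_
        rw [h6]
        refine zp_smul_mem _ _ ((Submodule.Quotient.mk_eq_zero M).1 ?_)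
        rw [Submodule.Quotient.mk_sub, sub_eq_zero, Submodule.Quotient.mk_smul]
        exact hvz.trans (by rw [← hz]; rfl)
      have h8 := (hc i).2 _ h7
      rw [hf, add_comm, pow_add, mul_smul, h6, smul_smul, ← pow_add, smul_sub, smul_smul,
        ← pow_add] at h8
      have h9 := sub_mem (zp_smul_mem _ ((p : ℤ_[p]) ^ (c + c)) hv) h8
      rwa [sub_sub_cancel, show c + c + (F + c') = F + (2 * c + c') by ring] at h9

end Lattices

/-! ### Abstract finite quotients of pro-`p` groups -/

section ProP

variable {p : ℕ} [Fact p.Prime] {G : Type*} [Group G]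

omit [Fact p.Prime] in
/-- Pro-`p` groups are divisible by every integer prime to `p`. -/
theorem IsProPGroup.exists_pow_eq [TopologicalSpace G] (hG : IsProPGroup p G) {m : ℕ}
    (hm : m.Coprime p) (g : G) : ∃ h : G, h ^ m = g := by
  have := hG.isTopologicalGroup
  have := hG.compactSpace
  have := hG.t2Space
  have := hG.totallyDisconnectedSpace
  have hcl : IsClosed (Set.range fun h : G => h ^ m) :=
    (isCompact_range (continuous_pow m)).isClosed
  suffices h : g ∈ closure (Set.range fun h : G => h ^ m) by
    rwa [hcl.closure_eq] at h
  refine mem_closure_iff.2 fun U hU hgU => ?_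
  obtain ⟨N, hN⟩ := ProfiniteGrp.exist_openNormalSubgroup_sub_open_nhds_of_one
    (U := (fun x => g * x) ⁻¹' U) (hU.preimage (continuous_const_mul g)) (by simpa using hgU)
  obtain ⟨n, hn⟩ := hG.index_eq_pow N.toSubgroup N.isNormal' N.isOpen'
  have hgN : g ^ p ^ n ∈ N.toSubgroup := hn ▸ Subgroup.pow_index_mem _ g
  -- With `a m + b p ^ n = 1`, the element `g (g ^ p ^ n) ^ (-b) = (g ^ a) ^ m` is an `m`-th power
  -- in the coset `g N`.
  have hbez := Nat.gcd_eq_gcd_ab m (p ^ n)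
  rw [Nat.Coprime.gcd_eq_one (hm.pow_right n)] at hbez
  set a := Nat.gcdA m (p ^ n)
  set b := Nat.gcdB m (p ^ n)
  have hpow : g * (g ^ p ^ n) ^ (-b) = (g ^ a) ^ m := by
    rw [← zpow_natCast g (p ^ n), ← zpow_natCast (g ^ a) m, ← zpow_mul, ← zpow_mul,
      ← zpow_one_add]
    congr 1
    push_cast at hbez ⊢
    linarith
  exact ⟨g * (g ^ p ^ n) ^ (-b), hN (N.toSubgroup.zpow_mem hgN _), g ^ a, hpow.symm⟩

/-- Abstract finite quotients of pro-`p` groups are `p`-groups. -/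
theorem IsProPGroup.isPGroup_range [TopologicalSpace G] (hG : IsProPGroup p G) {H : Type*}
    [Group H] [Finite H] (f : G →* H) : IsPGroup p f.range := by
  obtain ⟨e, m, hm, hcard⟩ := Nat.exists_eq_pow_mul_and_not_dvd (Nat.card_pos (α := H)).ne' p
    (Fact.out : p.Prime).ne_one
  rintro ⟨_, g, rfl⟩
  obtain ⟨h, rfl⟩ := hG.exists_pow_eq
    ((Nat.Prime.coprime_iff_not_dvd (Fact.out : p.Prime)).2 hm).symm g
  refine ⟨e, Subtype.ext ?_⟩
  show f (h ^ m) ^ p ^ e = 1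
  rw [map_pow, ← pow_mul, mul_comm, ← hcard, pow_card_eq_one']

end ProP

/-! ### Nilpotent action of `𝔞_G` modulo `p` -/

section PAugmentationIdeal

variable {p : ℕ} [Fact p.Prime] {G : Type*} [Group G]

theorem algebraMap_p_mem_pAugmentationIdeal :
    algebraMap ℤ_[p] (GroupRingOp p G) p ∈ pAugmentationIdeal p G := by
  rw [map_natCast]
  exact Ideal.subset_span (Set.mem_insert _ _)

variable (p G) in
/-- The vectors killed by `p` and fixed by `G`. -/
def pTorsionInvariants (X : Type*) [AddCommGroup X] [Module ℤ_[p] X] [Module (GroupRingOp p G) X]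
    [IsScalarTower ℤ_[p] (GroupRingOp p G) X] : Submodule (GroupRingOp p G) X where
  carrier := {x | (p : ℤ_[p]) • x = 0 ∧ ∀ g : G,
    (MulOpposite.op (MonoidAlgebra.of ℤ_[p] G g) : GroupRingOp p G) • x = x}
  zero_mem' := by simp
  add_mem' := fun {x y} hx hy =>
    ⟨by rw [smul_add, hx.1, hy.1, add_zero], fun g => by rw [smul_add, hx.2, hy.2]⟩
  smul_mem' := fun r x hx => by
    refine ⟨by rw [smul_comm, hx.1, smul_zero], ?_⟩
    obtain ⟨r, rfl⟩ := MulOpposite.op_surjective r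
    induction r using MonoidAlgebra.induction_on with
    | of h =>
      rw [hx.2]
      exact hx.2
    | add r s hr hs =>
      intro g
      rw [MulOpposite.op_add, add_smul, smul_add, hr, hs]
    | smul a r hr =>
      intro g
      rw [MulOpposite.op_smul, smul_assoc, smul_comm, hr]

variable {X : Type*} [AddCommGroup X] [Module ℤ_[p] X] [Module (GroupRingOp p G) X]
    [IsScalarTower ℤ_[p] (GroupRingOp p G) X]

theorem pAugmentationIdeal_smul_pTorsionInvariants :
    pAugmentationIdeal p G • pTorsionInvariants p G X = ⊥ := by
  refine le_bot_iff.1 (Submodule.smul_le.2 fun r hr x hx => ?_)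
  rw [Submodule.mem_bot]
  induction hr using Submodule.span_induction with
  | mem s hs =>
    rcases hs with rfl | ⟨g, rfl⟩
    · have h := hx.1
      rw [← algebraMap_smul (GroupRingOp p G), map_natCast] at h
      exact h
    · have h := hx.2 g
      simp only
      rw [MulOpposite.op_sub, sub_smul, h, MulOpposite.op_one, one_smul, sub_self]
  | zero => exact zero_smul _ _
  | add r s _ _ hr hs => rw [add_smul, hr, hs, add_zero]
  | smul a r _ hr => rw [smul_eq_mul, mul_smul, hr, smul_zero]

/-- The image of `G` in the permutations of `X` is a `p`-group, without any continuity of the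
action. It fixes `0`, so counting orbits modulo `p` yields another fixed point. -/
theorem pTorsionInvariants_ne_bot [TopologicalSpace G] (hG : IsProPGroup p G) [Finite X]
    (hp : ∀ x : X, (p : ℤ_[p]) • x = 0) (hX : p ∣ Nat.card X) :
    pTorsionInvariants p G X ≠ ⊥ := by
  -- Inversion turns the right action into a left one.
  let ψ : G →* GroupRingOp p G :=
    { toFun := fun g => MulOpposite.op (MonoidAlgebra.of ℤ_[p] G g⁻¹)
      map_one' := by rw [inv_one, map_one, MulOpposite.op_one]
      map_mul' := fun g h => by rw [mul_inv_rev, map_mul, MulOpposite.op_mul] }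
  let _ : MulAction G X := MulAction.compHom X ψ
  let φ := MulAction.toPermHom G X
  obtain ⟨x, hx, hx0⟩ := (hG.isPGroup_range φ).exists_fixed_point_of_prime_dvd_card_of_fixed_point X
    hX (a := 0) (by
      rintro ⟨_, g, rfl⟩
      exact smul_zero (ψ g))
  refine fun h => hx0.symm ((Submodule.eq_bot_iff _).1 h x ⟨hp x, fun g => ?_⟩)
  have := hx ⟨φ g⁻¹, g⁻¹, rfl⟩
  change ψ g⁻¹ • x = x at this
  simpa [ψ] using this

/-- Dividing by the fixed vectors lowers the order by a factor of at least `p`, and one factor of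
`𝔞_G` kills those vectors. -/
theorem pAugmentationIdeal_pow_smul_eq_bot [TopologicalSpace G] (hG : IsProPGroup p G) (n : ℕ) :
    ∀ (X : Type*) [AddCommGroup X] [Module ℤ_[p] X] [Module (GroupRingOp p G) X]
      [IsScalarTower ℤ_[p] (GroupRingOp p G) X] [Finite X], (∀ x : X, (p : ℤ_[p]) • x = 0) →
      Nat.card X ∣ p ^ n → pAugmentationIdeal p G ^ n • (⊤ : Submodule (GroupRingOp p G) X) = ⊥ := by
  have hdvd : ∀ k m : ℕ, m ∣ p ^ k → m ≠ 1 → p ∣ m := fun k m h h1 => by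
    obtain ⟨j, -, rfl⟩ := (Nat.dvd_prime_pow (Fact.out : p.Prime)).1 h
    exact dvd_pow_self p fun h0 => h1 (by rw [h0, pow_zero])
  induction n with
  | zero =>
    intro X _ _ _ _ _ _ hX
    rw [pow_zero, Nat.dvd_one, Nat.card_eq_one_iff_unique] at hX
    have := hX.1
    exact Subsingleton.elim _ _
  | succ n ih =>
    intro X _ _ _ _ _ hp hX
    rcases subsingleton_or_nontrivial X with h | h
    · exact Subsingleton.elim _ _
    have hA := pTorsionInvariants_ne_bot hG hp (hdvd _ _ hX Finite.one_lt_card.ne')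
    set A := pTorsionInvariants p G X with hAdef
    have hcard := Submodule.card_eq_card_quotient_mul_card A
    have hpA : p ∣ Nat.card A := by
      have := Submodule.nontrivial_iff_ne_bot.2 hA
      exact hdvd _ _ ((hcard ▸ dvd_mul_right _ _ : Nat.card A ∣ Nat.card X).trans hX)
        Finite.one_lt_card.ne'
    have hQ : Nat.card (X ⧸ A) ∣ p ^ n := by
      rw [hcard, pow_succ'] at hX
      exact Nat.dvd_of_mul_dvd_mul_left (Fact.out : p.Prime).pos
        ((Nat.mul_dvd_mul_right hpA _).trans hX)
    have : Finite (X ⧸ A) := Finite.of_surjective _ A.mkQ_surjective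
    have h0 := ih (X ⧸ A) (fun x => by
      obtain ⟨x, rfl⟩ := A.mkQ_surjective x
      exact congrArg A.mkQ (hp x)) hQ
    have h1 : pAugmentationIdeal p G ^ n • (⊤ : Submodule (GroupRingOp p G) X) ≤ A := by
      rw [← A.ker_mkQ, LinearMap.le_ker_iff_map, Submodule.map_smul'', Submodule.map_top,
        Submodule.range_mkQ, h0]
    rw [ideal_pow_succ_smul', ← le_bot_iff, ← pAugmentationIdeal_smul_pTorsionInvariants]
    exact Submodule.smul_mono le_rfl h1

open scoped Pointwise in
theorem pAugmentationIdeal_pow_finrank_smul_le [TopologicalSpace G] (hG : IsProPGroup p G)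
    (L : Type*) [AddCommGroup L] [Module ℤ_[p] L] [Module (GroupRingOp p G) L]
    [IsScalarTower ℤ_[p] (GroupRingOp p G) L] [Module.Finite ℤ_[p] L]
    [Module.IsTorsionFree ℤ_[p] L] :
    pAugmentationIdeal p G ^ Module.finrank ℤ_[p] L • (⊤ : Submodule (GroupRingOp p G) L) ≤
      (p : ℤ_[p]) ^ 1 • (⊤ : Submodule (GroupRingOp p G) L) := by
  set P := (p : ℤ_[p]) ^ 1 • (⊤ : Submodule (GroupRingOp p G) L) with hP
  obtain ⟨f, hf⟩ := exists_linearMap_zmod_pow p L 1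
  have : NeZero (p ^ 1) := ⟨pow_ne_zero _ (Fact.out : p.Prime).ne_zero⟩
  have hker : f.ker ≤ P.toAddSubgroup := fun x hx => by
    obtain ⟨w, rfl⟩ := hf x hx
    exact pow_smul_mem_pow_smul_top 1 w
  have hcard : Nat.card (L ⧸ P) ∣ p ^ Module.finrank ℤ_[p] L := by
    have h1 : P.toAddSubgroup.index ∣ Nat.card f.range :=
      AddSubgroup.index_ker f ▸ AddSubgroup.index_dvd_of_le hker
    refine (h1.trans f.range.card_addSubgroup_dvd_card).trans ?_
    simp
  have : Finite (L ⧸ P) := Nat.finite_of_card_ne_zero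
    (ne_zero_of_dvd_ne_zero (pow_ne_zero _ (Fact.out : p.Prime).ne_zero) hcard)
  have h0 := pAugmentationIdeal_pow_smul_eq_bot hG _ (L ⧸ P) (fun x => by
    obtain ⟨x, rfl⟩ := P.mkQ_surjective x
    refine (Submodule.Quotient.mk_eq_zero P).2 ?_
    have := pow_smul_mem_pow_smul_top (R := GroupRingOp p G) (p := p) 1 x
    rwa [← hP, pow_one] at this) hcard
  rw [← P.ker_mkQ, LinearMap.le_ker_iff_map, Submodule.map_smul'', Submodule.map_top,
    Submodule.range_mkQ, h0]

end PAugmentationIdeal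

/-! ### Stratifications of the lower `p`-series -/

section Stratification

open scoped Pointwise

variable {p : ℕ} [Fact p.Prime] {G : Type*} [Group G] {L : Type*} [AddCommGroup L]
  [Module ℤ_[p] L] [Module (GroupRingOp p G) L] [IsScalarTower ℤ_[p] (GroupRingOp p G) L]

theorem mem_lowerPSeries {i : ℕ} {x : L} : x ∈ lowerPSeries p G L i ↔
    x ∈ pAugmentationIdeal p G ^ i • (⊤ : Submodule (GroupRingOp p G) L) :=
  Iff.rfl

theorem smul_mem_lowerPSeries (r : GroupRingOp p G) {i : ℕ} {x : L}
    (hx : x ∈ lowerPSeries p G L i) : r • x ∈ lowerPSeries p G L i :=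
  Submodule.smul_mem (pAugmentationIdeal p G ^ i • (⊤ : Submodule (GroupRingOp p G) L)) r hx

theorem pow_smul_mem_lowerPSeries (i : ℕ) (x : L) : (p : ℤ_[p]) ^ i • x ∈ lowerPSeries p G L i :=
  pow_smul_le_ideal_pow_smul algebraMap_p_mem_pAugmentationIdeal ⊤ i
    (pow_smul_mem_pow_smul_top i x)

variable [Module.Finite ℤ_[p] L] [Module.IsTorsionFree ℤ_[p] L]

theorem exists_of_mem_lowerPSeries_finrank_mul [TopologicalSpace G] (hG : IsProPGroup p G) (n : ℕ)
    {x : L} (hx : x ∈ lowerPSeries p G L (Module.finrank ℤ_[p] L * n)) :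
    ∃ y, x = (p : ℤ_[p]) ^ n • y := by
  have := ideal_pow_mul_smul_le (pAugmentationIdeal_pow_finrank_smul_le hG L) n hx
  rw [one_mul] at this
  exact exists_of_mem_pow_smul_top this

theorem isFiltrationSeries_lowerPSeries [TopologicalSpace G] (hG : IsProPGroup p G) :
    IsFiltrationSeries p (lowerPSeries p G L) where
  zero_eq_top := by
    rw [lowerPSeries, ideal_pow_zero_smul, Submodule.restrictScalars_top]
  antitone := fun _ _ h => ideal_pow_smul_antitone (pAugmentationIdeal p G) ⊤ h
  isOpen := fun i => ⟨i, pow_smul_mem_lowerPSeries i⟩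
  iInf_eq_bot := (Submodule.eq_bot_iff _).2 fun x hx =>
    eq_zero_of_forall_mem_pow_smul (p := p) fun n =>
      exists_of_mem_lowerPSeries_finrank_mul hG n ((Submodule.mem_iInf _).1 hx _)

section Growth

variable {d : ℕ} {x : Module.Basis (Fin d) ℤ_[p] L} {ξ : Fin d → ℝ}

omit [Module.Finite ℤ_[p] L] [Module.IsTorsionFree ℤ_[p] L] in
theorem HasGrowth.le_one (h : HasGrowth (lowerPSeries p G L) x ξ) (k : Fin d) : ξ k ≤ 1 := by
  obtain ⟨c, hc⟩ := h
  refine le_of_floor_mul_le_add (C := c) zero_le_one fun i hi => ?_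
  have h1 := (hc i hi).1 _ (pow_smul_mem_lowerPSeries (G := G) i (x k)) k
  rw [map_smul, Finsupp.smul_apply, Module.Basis.repr_self, Finsupp.single_eq_same, smul_eq_mul,
    mul_one, ← pow_add] at h1
  rw [mul_one, Nat.floor_natCast, add_comm]
  exact le_of_pow_dvd_pow h1

theorem HasGrowth.one_div_le [TopologicalSpace G] (hG : IsProPGroup p G)
    (hd : Module.finrank ℤ_[p] L = d) (h : HasGrowth (lowerPSeries p G L) x ξ) (k : Fin d) :
    1 / (d : ℝ) ≤ ξ k := by
  obtain ⟨c, hc⟩ := h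
  have hd0 : 0 < d := k.pos
  have h1 : ∀ n : ℕ, 1 ≤ n → n ≤ ⌊((d * n : ℕ) : ℝ) * ξ k⌋₊ + c := fun n hn => by
    have hmem := (hc (d * n) (Nat.mul_pos hd0 hn)).2 k
    obtain ⟨y, hy⟩ := exists_of_mem_lowerPSeries_finrank_mul hG n (by rw [hd]; exact hmem)
    have h2 := congrArg (fun u => x.repr u k) hy
    simp only [map_smul, Finsupp.smul_apply, Module.Basis.repr_self, Finsupp.single_eq_same,
      smul_eq_mul, mul_one] at h2
    exact le_of_pow_dvd_pow ⟨_, h2⟩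
  -- For negative `ξ k` the natural floor is `0`, and `n = c + 1` would give `c + 1 ≤ c`.
  have hξ : 0 ≤ ξ k := by
    by_contra! hlt
    have h2 := h1 (c + 1) (Nat.le_add_left 1 c)
    rw [Nat.floor_of_nonpos (mul_nonpos_of_nonneg_of_nonpos (Nat.cast_nonneg _) hlt.le)] at h2
    omega
  have hd' : (0 : ℝ) < d := Nat.cast_pos.2 hd0
  rw [div_le_iff₀ hd', mul_comm]
  refine le_of_floor_mul_le_add (C := c) (mul_nonneg hd'.le hξ) fun n hn => ?_
  rw [mul_one, Nat.floor_natCast, ← mul_assoc, mul_comm (n : ℝ), ← Nat.cast_mul]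
  exact h1 n hn

theorem HasGrowth.isStratification [TopologicalSpace G] (hG : IsProPGroup p G)
    (hd : Module.finrank ℤ_[p] L = d) (h : HasGrowth (lowerPSeries p G L) x ξ)
    (hξ : Monotone ξ) : IsStratification p (lowerPSeries p G L) x ξ where
  isFiltrationSeries := isFiltrationSeries_lowerPSeries hG
  pos := fun k => (one_div_pos.2 (Nat.cast_pos.2 k.pos)).trans_le (h.one_div_le hG hd k)
  monotone := hξ
  equivalent := exists_cEquivalent_iff.2 h

omit [Module.Finite ℤ_[p] L] [Module.IsTorsionFree ℤ_[p] L]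

theorem HasGrowth.repr_smul_eq_zero (h : HasGrowth (lowerPSeries p G L) x ξ) (hξ : ∀ k, 0 ≤ ξ k)
    (r : GroupRingOp p G) {k j : Fin d} (hkj : ξ k < ξ j) : x.repr (r • x k) j = 0 :=
  h.repr_apply_eq_zero h hξ (DistribSMul.toLinearMap ℤ_[p] L r)
    (fun _ _ hz => smul_mem_lowerPSeries r hz) hkj

/-- Matrix entries of `g` only go from a direction to equally fast or slower ones, whose coordinates
need no more divisibility by `p`. -/
theorem HasGrowth.isGInvariant_stratum (h : HasGrowth (lowerPSeries p G L) x ξ)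
    (hξ : ∀ k, 0 ≤ ξ k) (i : ℕ) : IsGInvariant p G (stratum p x ξ i) := by
  intro g y hy
  set r : GroupRingOp p G := MulOpposite.op (MonoidAlgebra.of ℤ_[p] G g)
  rw [mem_stratum_iff] at hy ⊢
  intro j
  rw [← x.sum_repr y, Finset.smul_sum, map_sum, Finsupp.finsetSum_apply]
  refine Finset.dvd_sum fun k _ => ?_
  rw [smul_comm, map_smul, Finsupp.smul_apply, smul_eq_mul]
  rcases lt_or_ge (ξ k) (ξ j) with hlt | hle
  · rw [h.repr_smul_eq_zero hξ r hlt, mul_zero]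
    exact dvd_zero _
  · refine Dvd.dvd.mul_right ((pow_dvd_pow _ (Nat.floor_mono ?_)).trans (hy k)) _
    exact mul_le_mul_of_nonneg_left hle (Nat.cast_nonneg i)

theorem HasGrowth.isGInvariant_span (h : HasGrowth (lowerPSeries p G L) x ξ)
    (hξ : ∀ k, 0 ≤ ξ k) (hm : Monotone ξ) {e e' : Fin d} (he : (e' : ℕ) = (e : ℕ) + 1)
    (hlt : ξ e < ξ e') : IsGInvariant p G (Submodule.span ℤ_[p] (x '' {k | k ≤ e})) := by
  intro g y hy
  set r : GroupRingOp p G := MulOpposite.op (MonoidAlgebra.of ℤ_[p] G g)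
  refine (Submodule.span_le (p := (Submodule.span ℤ_[p] (x '' {k | k ≤ e})).comap
    (DistribSMul.toLinearMap ℤ_[p] L r))).2 ?_ hy
  rintro _ ⟨k, hk, rfl⟩
  show r • x k ∈ Submodule.span ℤ_[p] (x '' {k | k ≤ e})
  rw [x.mem_span_image]
  intro j hj
  by_contra hje
  refine Finsupp.mem_support_iff.1 hj (h.repr_smul_eq_zero hξ r ?_)
  have hej : e' ≤ j := by
    rw [Fin.le_def, he]
    exact Fin.lt_def.1 (not_le.1 hje)
  exact ((hm hk).trans_lt hlt).trans_le (hm hej)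

end Growth

theorem exists_isStratification_lowerPSeries [TopologicalSpace G] (hG : IsProPGroup p G) {d : ℕ}
    (hd : Module.finrank ℤ_[p] L = d) :
    ∃ (x : Module.Basis (Fin d) ℤ_[p] L) (ξ : Fin d → ℝ),
      IsStratification p (lowerPSeries p G L) x ξ ∧ ∀ k, ∃ q : ℚ, ξ k = q := by
  obtain ⟨ι, x, ξ, hι, hξ, h⟩ :=
    exists_hasGrowth (algebraMap_p_mem_pAugmentationIdeal (p := p) (G := G)) _ L rfl
  let e₀ : ι ≃ Fin d := Finite.equivFinOfCardEq ((Module.finrank_eq_nat_card_basis x).symm.trans hd)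
  -- The frame is reordered so that the rates increase.
  let e : ι ≃ Fin d := e₀.trans (Tuple.sort (ξ ∘ e₀.symm)).symm
  exact ⟨x.reindex e, ξ ∘ e.symm,
    (h.reindex e).isStratification hG hd (Tuple.monotone_sort (ξ ∘ e₀.symm)), fun k => hξ _⟩

omit [Module.Finite ℤ_[p] L] [Module.IsTorsionFree ℤ_[p] L] in
theorem IsStratification.growth_unique {d : ℕ} {S : ℕ → Submodule ℤ_[p] L}
    {x y : Module.Basis (Fin d) ℤ_[p] L} {ξ η : Fin d → ℝ} (hx : IsStratification p S x ξ)
    (hy : IsStratification p S y η) : ξ = η := by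
  have hx' := exists_cEquivalent_iff.1 hx.equivalent
  have hy' := exists_cEquivalent_iff.1 hy.equivalent
  exact funext fun k => le_antisymm
    (hy'.le_of_monotone hx' (fun k => (hy.pos k).le) hy.monotone hx.monotone k)
    (hx'.le_of_monotone hy' (fun k => (hx.pos k).le) hx.monotone hy.monotone k)

end Stratification

theorem theorem1p1 (p : ℕ) [Fact p.Prime]
    (G : Type*) [Group G] [TopologicalSpace G]
    (hG : IsProPGroup p G) (hfg : IsTopFinitelyGenerated G)
    (L : Type*) [AddCommGroup L] [Module ℤ_[p] L] [Module (GroupRingOp p G) L]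
    [IsScalarTower ℤ_[p] (GroupRingOp p G) L]
    [Module.Finite ℤ_[p] L] [Module.IsTorsionFree ℤ_[p] L]
    (d : ℕ) (hd : Module.finrank ℤ_[p] L = d) :
    -- the lower `p`-series is a filtration series and admits a stratification
    IsFiltrationSeries p (lowerPSeries p G L) ∧
    (∃ (x : Module.Basis (Fin d) ℤ_[p] L) (ξ : Fin d → ℝ),
      IsStratification p (lowerPSeries p G L) x ξ) ∧
    -- any two stratifications have the same growth rate
    (∀ (x y : Module.Basis (Fin d) ℤ_[p] L) (ξ η : Fin d → ℝ),
      IsStratification p (lowerPSeries p G L) x ξ →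
      IsStratification p (lowerPSeries p G L) y η → ξ = η) ∧
    -- properties of an arbitrary stratification
    (∀ (x : Module.Basis (Fin d) ℤ_[p] L) (ξ : Fin d → ℝ),
      IsStratification p (lowerPSeries p G L) x ξ →
      (Monotone ξ ∧ ∀ k, 1 / (d : ℝ) ≤ ξ k ∧ ξ k ≤ 1 ∧ ∃ q : ℚ, ξ k = (q : ℝ)) ∧
      (∀ e e' : Fin d, (e' : ℕ) = (e : ℕ) + 1 → ξ e < ξ e' →
        IsGInvariant p G (Submodule.span ℤ_[p] (x '' {k | k ≤ e}))) ∧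
      (∀ i : ℕ, IsGInvariant p G (stratum p x ξ i))) := by
  refine ⟨isFiltrationSeries_lowerPSeries hG, ?_, fun x y ξ η hx hy => hx.growth_unique hy,
    fun x ξ hx => ?_⟩
  · obtain ⟨x, ξ, h, -⟩ := exists_isStratification_lowerPSeries (G := G) hG hd
    exact ⟨x, ξ, h⟩
  · have hgr := exists_cEquivalent_iff.1 hx.equivalent
    have hpos := fun k => (hx.pos k).le
    refine ⟨⟨hx.monotone, fun k => ⟨hgr.one_div_le hG hd k, hgr.le_one k, ?_⟩⟩,
      fun e e' he hlt => hgr.isGInvariant_span hpos hx.monotone he hlt,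
      hgr.isGInvariant_stratum hpos⟩
    -- Rationality holds for the constructed stratification and transfers by uniqueness of the
    -- growth rate.
    obtain ⟨y, η, hy, hη⟩ := exists_isStratification_lowerPSeries (G := G) hG hd
    rw [hx.growth_unique hy]
    exact hη k
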